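/- Let $s\in(0,1)$ and let $f$ be the meromorphic function on $\mathbb{C}$ given by $$f(\beta)=\frac{\Gamma(\beta+1)\,\sin(\pi s)}{\Gamma(\beta-2s+1)\,\sin(\pi(\beta-2s))}\left(\frac{\sin(\pi(\beta-s))}{\sin(\pi s)}+\frac{\Gamma(2s-\beta)\,\Gamma(\beta+1)}{\Gamma(2s)}\right).$$ A zero of $f$ means a zero of this meromorphic function, i.e. a point at which its order is positive. Then the following hold. (i) If $s\le\frac12$, then there is $\alpha>0$ such that $f$ has no zeros in the strip $\{\beta\in\mathbb{C}: 0<\operatorname{Re}\beta<2s+\alpha\}$. Moreover, $f$ has at least one zero in the strip $\{\beta\in\mathbb{C}: 2s<\operatorname{Re}\beta<2s+\frac12\}$. (ii) If $s\ge\frac12$, then there is $\alpha>0$ such that $f$ has no zeros in the strip $\{\beta\in\mathbb{C}: 2s-1<\operatorname{Re}\beta<s+\frac12+\alpha\}$. Moreover, $f$ has at least one zero in the strip $\{\beta\in\mathbb{C}: s+\frac12<\operatorname{Re}\beta<s+1\}$. Here $\alpha$ may depend on $s$. -/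

import Mathlib

/-- The symbol `f` of the one-dimensional nonlocal Neumann problem of order `2s`, given by the
explicit Gamma/sine formula. As a meromorphic function on `ℂ` it is determined by this formula away
from the (discrete) set of points where a factor is singular; the values that Lean assigns at those
points play no role, since zeros are counted by `IsZeroOf`. -/
noncomputable def neumannSymbol (s : ℝ) (β : ℂ) : ℂ :=
  Complex.Gamma (β + 1) * Complex.sin (Real.pi * s) /
      (Complex.Gamma (β - 2 * s + 1) * Complex.sin (Real.pi * (β - 2 * s))) *
    (Complex.sin (Real.pi * (β - s)) / Complex.sin (Real.pi * s) +
      Complex.Gamma (2 * s - β) * Complex.Gamma (β + 1) / Complex.Gamma (2 * s))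

/-- `β` is a zero of the meromorphic function `g`: the order of `g` at `β` is positive. In
particular a pole is not a zero, and the value of `g` at the single point `β` is irrelevant. -/
def IsZeroOf (g : ℂ → ℂ) (β : ℂ) : Prop :=
  0 < meromorphicOrderAt g β

/-- The symbol is meromorphic on the whole complex plane. -/
theorem neumannSymbol_meromorphicAt (s : ℝ) (β : ℂ) : MeromorphicAt (neumannSymbol s) β := by
  have hG : ∀ {u : ℂ → ℂ}, AnalyticAt ℂ u β → MeromorphicAt (fun z => Complex.Gamma (u z)) β :=
    fun hu => (Meromorphic.Gamma _).comp_analyticAt hu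
  have h1 : MeromorphicAt (fun z : ℂ => Complex.Gamma (z + 1)) β := hG (by fun_prop)
  have h2 : MeromorphicAt (fun z : ℂ => Complex.Gamma (z - 2 * s + 1)) β := hG (by fun_prop)
  have h3 : MeromorphicAt (fun z : ℂ => Complex.Gamma (2 * s - z)) β := hG (by fun_prop)
  have h4 : ∀ c : ℂ, MeromorphicAt (fun z : ℂ => Complex.sin (Real.pi * (z - c))) β := fun c =>
    (Complex.analyticAt_sin.comp (f := fun z : ℂ => Real.pi * (z - c))
      (by fun_prop)).meromorphicAt
  have hc : ∀ c : ℂ, MeromorphicAt (fun _ : ℂ => c) β := fun c => MeromorphicAt.const c β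
  exact ((h1.mul (hc _)).div (h2.mul (h4 _))).mul
    (((h4 _).div (hc _)).add ((h3.mul h1).div (hc _)))

/-! Put z = β - s + 1/2 and let F be the entire function `cosRatio s`. By the reflection formula the
symbol is a nonzero constant times (Γ(β+1)Γ(2s-β))² (1 - F(z)). Since F contains the factor
1/(Γ(β+1)Γ(2s-β)), the zeros are exactly the solutions of F(z) = 1. F commutes with conjugation, so
the real axis and the upper half plane suffice.

Everything rests on one sign: Q = Γ(w+c)/Γ(w) has positive imaginary part for w in the open first
quadrant and 0 < c ≤ 2 (`Gamma_quotient_im_pos`). For two choices of w and c, F·Q is a positive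
multiple of an explicit trigonometric function (`cosRatio_mul_Gamma_quotient` and its reflected
form), from which the sign of Im F can be read off.

Absence of zeros: let m = min(s+1/2, 1) and |s-1/2| < Re z ≤ m. These signs exclude F = 1 off the
axis, and log-convexity of Γ gives F < 1 on it. As F grows along vertical lines, the solutions with
m ≤ Re z ≤ m+1 form a compact set, which therefore stays a distance α away from Re z = m.

Existence: in the half-strip m ≤ Re z ≤ 1+s/2, Im z ≥ 0, Im F is positive on the left edge and
negative on the right edge, so F takes a real value at every positive height. At a large height that
value is at least 2. The least real value of F in [1, L] on a suitable box must be 1, since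
otherwise the open mapping theorem would produce a smaller one. -/

/-! ### Quotients of Γ on the first quadrant -/

open Complex in
/-- Multiplication by `w / (w + c)` maps the cone spanned by `1` and `w + 1` into the cone spanned
by `1` and `w`. -/
theorem cone_step {w q : ℂ} {c : ℝ} (hx : 0 < w.re) (hy : 0 < w.im) (hc0 : 0 ≤ c) (hc1 : c ≤ 1)
    (h0 : 0 ≤ q.im) (h1 : q.im * (w.re + 1) ≤ q.re * w.im) :
    0 ≤ (w / (w + c) * q).im ∧ (w / (w + c) * q).im * w.re ≤ (w / (w + c) * q).re * w.im := by
  have hp : 0 ≤ q.re := by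
    by_contra! h
    nlinarith [mul_neg_of_neg_of_pos h hy, mul_nonneg h0 hx.le]
  have hN : 0 < normSq (w + c) := by
    rw [normSq_pos]; intro h; have := congrArg im h; simp at this; linarith
  have him : (w / (w + c) * q).im =
      ((w.re ^ 2 + w.im ^ 2 + c * w.re) * q.im + c * w.im * q.re) / normSq (w + c) := by
    simp only [mul_im, div_re, div_im, add_re, add_im, ofReal_re, ofReal_im]
    field_simp
    ring
  have hre : (w / (w + c) * q).re =
      ((w.re ^ 2 + w.im ^ 2 + c * w.re) * q.re - c * w.im * q.im) / normSq (w + c) := by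
    simp only [mul_re, div_re, div_im, add_re, add_im, ofReal_re, ofReal_im]
    field_simp
    ring
  refine ⟨by rw [him]; positivity, ?_⟩
  rw [him, hre, div_mul_eq_mul_div, div_mul_eq_mul_div]
  refine div_le_div_of_nonneg_right ?_ hN.le
  -- Since c ≤ 1, arg (w+1) ≤ arg (w+c), so q also lies in the cone spanned by 1 and w+c;
  -- multiplying by w/(w+c) then keeps the argument at most arg w.
  have h2 : 0 ≤ q.re * w.im - q.im * w.re - c * q.im := by
    nlinarith [mul_nonneg h0 (sub_nonneg.2 hc1)]
  nlinarith [mul_nonneg h2 (add_nonneg (sq_nonneg w.re) (sq_nonneg w.im))]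

theorem cone_prod {c : ℝ} (hc0 : 0 ≤ c) (hc1 : c ≤ 1) (n : ℕ) :
    ∀ {w : ℂ}, 0 < w.re → 0 < w.im →
      0 ≤ (∏ j ∈ Finset.range n, ((w + j) / (w + c + j))).im ∧
      (∏ j ∈ Finset.range n, ((w + j) / (w + c + j))).im * w.re ≤
        (∏ j ∈ Finset.range n, ((w + j) / (w + c + j))).re * w.im := by
  induction n with
  | zero => intro w _ hy; simp [hy.le]
  | succ n ih =>
    intro w hx hy
    have h := ih (w := w + 1) (by simp; linarith) (by simpa using hy)
    rw [Finset.prod_range_succ', mul_comm]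
    have e : ∏ k ∈ Finset.range n, ((w + (k + 1 : ℕ)) / (w + c + (k + 1 : ℕ))) =
        ∏ j ∈ Finset.range n, ((w + 1 + j) / (w + 1 + c + j)) :=
      Finset.prod_congr rfl fun k _ => by push_cast; congr 1 <;> ring
    rw [e]
    simp only [Complex.add_re, Complex.one_re, Complex.add_im, Complex.one_im, add_zero] at h
    simpa using cone_step hx hy hc0 hc1 h.1 h.2

open Complex Filter Topology in
/-- For `0 ≤ c ≤ 1` and `w` in the first quadrant, `Γ (w + c) / Γ w` lies in the closed cone
spanned by `1` and `w`. -/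
theorem Gamma_quotient_mem_cone {c : ℝ} (hc0 : 0 ≤ c) (hc1 : c ≤ 1) {w : ℂ} (hx : 0 < w.re)
    (hy : 0 < w.im) :
    0 ≤ (Gamma (w + c) / Gamma w).im ∧
      (Gamma (w + c) / Gamma w).im * w.re ≤ (Gamma (w + c) / Gamma w).re * w.im := by
  have hlim : Tendsto (fun n : ℕ => GammaSeq (w + c) n / GammaSeq w n) atTop
      (𝓝 (Gamma (w + c) / Gamma w)) :=
    (GammaSeq_tendsto_Gamma _).div (GammaSeq_tendsto_Gamma _) (Gamma_ne_zero_of_re_pos hx)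
  -- Euler's limit formula: up to the positive factor n^c, the quotient is the product treated in
  -- `cone_prod`.
  have key : ∀ᶠ n : ℕ in atTop, GammaSeq (w + c) n / GammaSeq w n =
      (((n : ℝ) ^ c : ℝ) : ℂ) * ∏ j ∈ Finset.range (n + 1), ((w + j) / (w + c + j)) := by
    filter_upwards [eventually_ge_atTop 1] with n hn
    have hn0 : (n : ℂ) ≠ 0 := Nat.cast_ne_zero.2 (by omega)
    have hf : (n.factorial : ℂ) ≠ 0 := Nat.cast_ne_zero.2 n.factorial_ne_zero
    have hw : (n : ℂ) ^ w ≠ 0 := by simp [cpow_eq_zero_iff, hn0]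
    have h1 : ∏ j ∈ Finset.range (n + 1), (w + c + j) ≠ 0 :=
      Finset.prod_ne_zero_iff.2 fun j _ h => by
        have := congrArg im h; simp at this; linarith
    have h2 : ∏ j ∈ Finset.range (n + 1), (w + j) ≠ 0 :=
      Finset.prod_ne_zero_iff.2 fun j _ h => by
        have := congrArg im h; simp at this; linarith
    rw [GammaSeq, GammaSeq, Finset.prod_div_distrib, cpow_add _ _ hn0,
      ofReal_cpow (Nat.cast_nonneg n)]
    push_cast
    field_simp
  have hpos : ∀ n : ℕ, 0 ≤ (n : ℝ) ^ c := fun n => by positivity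
  have hcone : ∀ᶠ n : ℕ in atTop, 0 ≤ (GammaSeq (w + c) n / GammaSeq w n).im ∧
      (GammaSeq (w + c) n / GammaSeq w n).im * w.re ≤
        (GammaSeq (w + c) n / GammaSeq w n).re * w.im := by
    filter_upwards [key] with n hn
    have h := cone_prod hc0 hc1 (n + 1) hx hy
    rw [hn, im_ofReal_mul, re_ofReal_mul, mul_assoc, mul_assoc]
    exact ⟨mul_nonneg (hpos n) h.1, mul_le_mul_of_nonneg_left h.2 (hpos n)⟩
  have him := (continuous_im.tendsto _).comp hlim
  have hre := (continuous_re.tendsto _).comp hlim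
  exact ⟨ge_of_tendsto him (hcone.mono fun n h => h.1),
    le_of_tendsto_of_tendsto (him.mul_const _) (hre.mul_const _) (hcone.mono fun n h => h.2)⟩

-- Strictness comes from a shift: if the quotient q at w were real, it would be positive, and the
-- quotient at w+1, which is q (w+c)/w, would have negative imaginary part, against the cone bound
-- there.
open Complex in
theorem Gamma_quotient_im_pos_of_le_one {c : ℝ} (hc0 : 0 < c) (hc1 : c ≤ 1) {w : ℂ}
    (hx : 0 < w.re) (hy : 0 < w.im) : 0 < (Gamma (w + c) / Gamma w).im := by
  obtain ⟨h0, h1⟩ := Gamma_quotient_mem_cone hc0.le hc1 hx hy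
  refine lt_of_le_of_ne h0 fun hne => ?_
  have hw0 : w ≠ 0 := fun h => by simp [h] at hx
  have hwc0 : w + c ≠ 0 := fun h => by
    have := congrArg im h; simp at this; linarith
  have hG : Gamma w ≠ 0 := Gamma_ne_zero_of_re_pos hx
  have hGc : Gamma (w + c) ≠ 0 := Gamma_ne_zero_of_re_pos (by simp; linarith)
  set q := Gamma (w + c) / Gamma w with hq
  have hq0 : q ≠ 0 := div_ne_zero hGc hG
  have hre : 0 < q.re := by
    rw [← hne, zero_mul] at h1
    refine lt_of_le_of_ne (nonneg_of_mul_nonneg_left h1 hy) fun h => hq0 ?_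
    exact Complex.ext h.symm hne.symm
  have h2 := (Gamma_quotient_mem_cone hc0.le hc1 (w := w + 1) (by simp; linarith)
    (by simpa using hy)).1
  have e : Gamma (w + 1 + c) / Gamma (w + 1) = (w + c) / w * q := by
    rw [add_right_comm, Gamma_add_one _ hwc0, Gamma_add_one _ hw0, hq]
    field_simp
  have him : ((w + c) / w * q).im = -(c * w.im * q.re) / normSq w := by
    have hN : normSq w ≠ 0 := by simpa using hw0
    simp only [mul_im, div_re, div_im, add_re, add_im, ofReal_re, ofReal_im, ← hne]
    field_simp
    ring
  rw [e, him] at h2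
  have : 0 < c * w.im * q.re / normSq w := by
    have := normSq_pos.2 hw0
    positivity
  rw [neg_div] at h2
  linarith

open Complex in
theorem Gamma_quotient_re_pos {c : ℝ} (hc0 : 0 < c) (hc1 : c ≤ 1) {w : ℂ} (hx : 0 < w.re)
    (hy : 0 < w.im) : 0 < (Gamma (w + c) / Gamma w).re := by
  have h0 := Gamma_quotient_im_pos_of_le_one hc0 hc1 hx hy
  have h1 := (Gamma_quotient_mem_cone hc0.le hc1 hx hy).2
  exact pos_of_mul_pos_left ((mul_pos h0 hx).trans_le h1) hy.le

open Complex in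
/-- For `0 < c ≤ 2`, the quotient `Γ (w + c) / Γ w` maps the first quadrant into the upper half
plane. -/
theorem Gamma_quotient_im_pos {c : ℝ} (hc0 : 0 < c) (hc2 : c ≤ 2) {w : ℂ} (hx : 0 < w.re)
    (hy : 0 < w.im) : 0 < (Gamma (w + c) / Gamma w).im := by
  rcases le_or_gt c 1 with hc1 | hc1
  · exact Gamma_quotient_im_pos_of_le_one hc0 hc1 hx hy
  · have h0 := Gamma_quotient_im_pos_of_le_one (c := c - 1) (by linarith) (by linarith) hx hy
    have h1 := Gamma_quotient_re_pos (c := c - 1) (by linarith) (by linarith) hx hy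
    have hne : w + (c - 1 : ℝ) ≠ 0 := fun h => by
      have := congrArg im h; simp at this; linarith
    -- Splitting off one factor leaves a product of two points of the open first quadrant.
    have e : Gamma (w + c) / Gamma w =
        (w + (c - 1 : ℝ)) * (Gamma (w + (c - 1 : ℝ)) / Gamma w) := by
      rw [← mul_div_assoc, ← Gamma_add_one _ hne]
      push_cast
      congr 2
      ring
    rw [e, mul_im]
    simp only [add_re, add_im, ofReal_re, ofReal_im, add_zero]
    have : 0 < w.re + (c - 1) := by linarith
    positivity

/-! ### Modulus and log-convexity of Γ -/

open Complex MeasureTheory in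
theorem norm_Gamma_le_Gamma_re {w : ℂ} (hw : 0 < w.re) : ‖Gamma w‖ ≤ Real.Gamma w.re := by
  rw [Gamma_eq_integral hw, Real.Gamma_eq_integral hw, GammaIntegral]
  refine (norm_integral_le_integral_norm _).trans_eq
    (setIntegral_congr_fun measurableSet_Ioi fun x hx => ?_)
  have hx' : 0 < x := hx
  simp [norm_cpow_eq_rpow_re_of_pos hx', Complex.norm_exp]

/-- Moving two positive arguments apart while keeping their sum does not decrease the product of
the values of `Γ`. -/
theorem Real.Gamma_mul_Gamma_le_of_spread {p q u v : ℝ} (hp : 0 < p) (hpu : p ≤ u) (huq : u ≤ q)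
    (hsum : p + q = u + v) :
    Real.Gamma u * Real.Gamma v ≤ Real.Gamma p * Real.Gamma q := by
  have hq : 0 < q := by linarith
  have hu : 0 < u := by linarith
  have hv : 0 < v := by linarith
  rcases eq_or_lt_of_le (hpu.trans huq) with h | h
  · have : u = p := by linarith
    have : v = q := by linarith
    simp [*]
  have hd : 0 < q - p := by linarith
  have hc := Real.convexOn_log_Gamma.2
  have ha : 0 ≤ (q - u) / (q - p) := div_nonneg (by linarith) hd.le
  have hb : 0 ≤ (u - p) / (q - p) := div_nonneg (by linarith) hd.le
  have hab : (q - u) / (q - p) + (u - p) / (q - p) = 1 := by field_simp; ring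
  have h1 := hc (Set.mem_Ioi.2 hp) (Set.mem_Ioi.2 hq) ha hb hab
  have h2 := hc (Set.mem_Ioi.2 hp) (Set.mem_Ioi.2 hq) hb ha (by rw [add_comm]; exact hab)
  have e1 : (q - u) / (q - p) * p + (u - p) / (q - p) * q = u := by field_simp; ring
  have e2 : (u - p) / (q - p) * p + (q - u) / (q - p) * q = v := by
    have : v = p + q - u := by linarith
    rw [this]; field_simp; ring
  simp only [smul_eq_mul, Function.comp_apply] at h1 h2
  rw [e1] at h1
  rw [e2] at h2
  have hG := fun {t : ℝ} (ht : 0 < t) => Real.Gamma_pos_of_pos ht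
  rw [← Real.log_le_log_iff (mul_pos (hG hu) (hG hv)) (mul_pos (hG hp) (hG hq)),
    Real.log_mul (hG hu).ne' (hG hv).ne', Real.log_mul (hG hp).ne' (hG hq).ne']
  set a := (q - u) / (q - p)
  set b := (u - p) / (q - p)
  have hb' : b = 1 - a := by linarith
  rw [hb'] at h1 h2
  linarith

/-! ### The entire function F = `cosRatio s` and the signs of its imaginary part -/

/-- The entire function `cos (π z) Γ (2 s) / (sin (π s) Γ (s + 1/2 + z) Γ (s + 1/2 - z))`. In the
variable `z = β - s + 1/2` the zeros of `neumannSymbol s` are the points where it equals `1`. -/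
noncomputable def cosRatio (s : ℝ) (z : ℂ) : ℂ :=
  Complex.cos (Real.pi * z) * ((Complex.Gamma (s + 1 / 2 + z))⁻¹ *
    (Complex.Gamma (s + 1 / 2 - z))⁻¹) * ((Real.Gamma (2 * s) / Real.sin (Real.pi * s) : ℝ) : ℂ)

theorem sin_pi_mul_pos {s : ℝ} (hs0 : 0 < s) (hs1 : s < 1) : 0 < Real.sin (Real.pi * s) :=
  Real.sin_pos_of_pos_of_lt_pi (by positivity) (by nlinarith [Real.pi_pos])

theorem Gamma_div_sin_pos {s : ℝ} (hs0 : 0 < s) (hs1 : s < 1) :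
    0 < Real.Gamma (2 * s) / Real.sin (Real.pi * s) :=
  div_pos (Real.Gamma_pos_of_pos (by linarith)) (sin_pi_mul_pos hs0 hs1)

theorem differentiable_cosRatio (s : ℝ) : Differentiable ℂ (cosRatio s) := by
  unfold cosRatio
  refine ((Complex.differentiable_cos.comp (differentiable_id.const_mul _)).mul
    (Differentiable.mul ?_ ?_)).mul_const _
  · exact Complex.differentiable_one_div_Gamma.comp (differentiable_id.const_add _)
  · exact Complex.differentiable_one_div_Gamma.comp (differentiable_id.const_sub _)

open Complex ComplexConjugate in
theorem cosRatio_conj (s : ℝ) (z : ℂ) : cosRatio s (conj z) = conj (cosRatio s z) := by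
  simp only [cosRatio, map_mul, map_inv₀, ← Gamma_conj, ← cos_conj, map_add, map_sub, map_div₀,
    conj_ofReal, map_one, map_ofNat]

theorem cosRatio_ofReal (s x : ℝ) : cosRatio s x =
    ((Real.cos (Real.pi * x) * ((Real.Gamma (s + 1 / 2 + x))⁻¹ * (Real.Gamma (s + 1 / 2 - x))⁻¹) *
      (Real.Gamma (2 * s) / Real.sin (Real.pi * s)) : ℝ) : ℂ) := by
  simp only [cosRatio, Complex.ofReal_mul, Complex.ofReal_inv, ← Complex.Gamma_ofReal,
    Complex.ofReal_cos, Complex.ofReal_add, Complex.ofReal_sub, Complex.ofReal_div,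
    Complex.ofReal_one, Complex.ofReal_ofNat]

theorem pi_mul_eq_add_mul_I (z : ℂ) : (Real.pi : ℂ) * z =
    ((Real.pi * z.re : ℝ) : ℂ) + ((Real.pi * z.im : ℝ) : ℂ) * Complex.I := by
  apply Complex.ext <;> simp

theorem cos_pi_mul_re (z : ℂ) : (Complex.cos (Real.pi * z)).re =
    Real.cos (Real.pi * z.re) * Real.cosh (Real.pi * z.im) := by
  rw [pi_mul_eq_add_mul_I, Complex.cos_add_mul_I, ← Complex.ofReal_cos, ← Complex.ofReal_cosh,
    ← Complex.ofReal_sin, ← Complex.ofReal_sinh]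
  simp only [Complex.sub_re, Complex.mul_re, Complex.mul_im, Complex.ofReal_re,
    Complex.ofReal_im, Complex.I_re, Complex.I_im]
  ring

theorem cos_pi_mul_im (z : ℂ) : (Complex.cos (Real.pi * z)).im =
    -(Real.sin (Real.pi * z.re) * Real.sinh (Real.pi * z.im)) := by
  rw [pi_mul_eq_add_mul_I, Complex.cos_add_mul_I, ← Complex.ofReal_cos, ← Complex.ofReal_cosh,
    ← Complex.ofReal_sin, ← Complex.ofReal_sinh]
  simp only [Complex.sub_im, Complex.mul_re, Complex.mul_im, Complex.ofReal_re,
    Complex.ofReal_im, Complex.I_re, Complex.I_im]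
  ring

theorem abs_sinh_le_norm_cos_pi_mul (z : ℂ) :
    |Real.sinh (Real.pi * z.im)| ≤ ‖Complex.cos (Real.pi * z)‖ := by
  rw [← Real.sqrt_sq_eq_abs, Complex.norm_def]
  refine Real.sqrt_le_sqrt ?_
  rw [Complex.normSq_apply, cos_pi_mul_re, cos_pi_mul_im]
  have h1 := Real.cosh_sq (Real.pi * z.im)
  have h2 := Real.sin_sq_add_cos_sq (Real.pi * z.re)
  have h3 : Real.sin (Real.pi * z.re) ^ 2 = 1 - Real.cos (Real.pi * z.re) ^ 2 := by linarith
  have e : Real.cos (Real.pi * z.re) * Real.cosh (Real.pi * z.im) *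
      (Real.cos (Real.pi * z.re) * Real.cosh (Real.pi * z.im)) +
      -(Real.sin (Real.pi * z.re) * Real.sinh (Real.pi * z.im)) *
      -(Real.sin (Real.pi * z.re) * Real.sinh (Real.pi * z.im)) =
      Real.cos (Real.pi * z.re) ^ 2 * Real.cosh (Real.pi * z.im) ^ 2 +
      Real.sin (Real.pi * z.re) ^ 2 * Real.sinh (Real.pi * z.im) ^ 2 := by ring
  rw [e, h1, h3]
  nlinarith [sq_nonneg (Real.cos (Real.pi * z.re))]

-- With w = s+1/2 - conj z one has w + 2 Re z = s+1/2+z, and Γ(w) is the conjugate of Γ(s+1/2-z);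
-- the Γ factors combine to the positive number 1/|Γ(w)|².
open Complex ComplexConjugate in
theorem cosRatio_mul_Gamma_quotient {s : ℝ} (hs0 : 0 < s) (hs1 : s < 1) {z : ℂ}
    (hx0 : 0 < z.re) (hxa : z.re < s + 1 / 2) : ∃ k : ℝ, 0 < k ∧
      cosRatio s z * (Gamma ((s + 1 / 2 - conj z) + (2 * z.re : ℝ)) /
        Gamma (s + 1 / 2 - conj z)) = k * cos (Real.pi * z) := by
  have hwre : 0 < ((s : ℂ) + 1 / 2 - conj z).re := by simp; linarith
  have hw : Gamma (s + 1 / 2 - conj z) ≠ 0 := Gamma_ne_zero_of_re_pos hwre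
  have e1 : (s : ℂ) + 1 / 2 - conj z + (2 * z.re : ℝ) = s + 1 / 2 + z := by
    apply Complex.ext <;> simp; ring
  have hp : Gamma (s + 1 / 2 + z) ≠ 0 := Gamma_ne_zero_of_re_pos (by simp; linarith)
  have e2 : Gamma (s + 1 / 2 - z) = conj (Gamma (s + 1 / 2 - conj z)) := by
    rw [← Gamma_conj, map_sub, map_add, map_div₀, conj_conj, conj_ofReal, map_one, map_ofNat]
  refine ⟨(normSq (Gamma (s + 1 / 2 - conj z)))⁻¹ *
    (Real.Gamma (2 * s) / Real.sin (Real.pi * s)),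
    mul_pos (inv_pos.2 (normSq_pos.2 hw)) (Gamma_div_sin_pos hs0 hs1), ?_⟩
  rw [e1, cosRatio, e2, ofReal_mul, ofReal_inv, ← mul_conj]
  have hw' : conj (Gamma (s + 1 / 2 - conj z)) ≠ 0 := by simpa using hw
  generalize ((Real.Gamma (2 * s) / Real.sin (Real.pi * s) : ℝ) : ℂ) = K
  generalize Gamma (s + 1 / 2 - conj z) = A at *
  generalize Gamma (s + 1 / 2 + z) = B at *
  field_simp

-- This form survives to the right of Re z = s+1/2: reflection replaces 1/Γ(s+1/2-z) by Γ(z+1/2-s)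
-- cos(π(z-s))/π, and the two cosines combine by the product-to-sum formula.
open Complex in
theorem cosRatio_mul_Gamma_quotient_reflected {s : ℝ} (hs0 : 0 < s) (hs1 : s < 1) {z : ℂ}
    (hx : s - 1 / 2 < z.re) : ∃ k : ℝ, 0 < k ∧
      cosRatio s z * (Gamma ((z + 1 / 2 - s) + (2 * s : ℝ)) / Gamma (z + 1 / 2 - s)) =
        k * (cos (Real.pi * s) + cos (Real.pi * (2 * z - s))) := by
  have hw : Gamma (z + 1 / 2 - s) ≠ 0 := Gamma_ne_zero_of_re_pos (by simp; linarith)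
  have hp : Gamma (s + 1 / 2 + z) ≠ 0 := Gamma_ne_zero_of_re_pos (by simp; linarith)
  have e1 : z + 1 / 2 - (s : ℂ) + (2 * s : ℝ) = s + 1 / 2 + z := by push_cast; ring
  have hpi : (Real.pi : ℂ) ≠ 0 := ofReal_ne_zero.2 Real.pi_ne_zero
  have hr := Gamma_mul_Gamma_one_sub (z + 1 / 2 - s)
  rw [show (1 : ℂ) - (z + 1 / 2 - s) = s + 1 / 2 - z by ring,
    show (Real.pi : ℂ) * (z + 1 / 2 - s) = Real.pi * (z - s) + Real.pi / 2 by ring,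
    sin_add_pi_div_two] at hr
  have e2 : (Gamma (s + 1 / 2 - z))⁻¹ =
      Gamma (z + 1 / 2 - s) * cos (Real.pi * (z - s)) / Real.pi := by
    have h : Gamma (s + 1 / 2 - z) =
        Real.pi / cos (Real.pi * (z - s)) / Gamma (z + 1 / 2 - s) := by
      rw [← hr, mul_div_cancel_left₀ _ hw]
    rw [h, inv_div, div_div_eq_mul_div]
  have e3 : cos (Real.pi * s) + cos (Real.pi * (2 * z - s)) =
      2 * cos (Real.pi * z) * cos (Real.pi * (z - s)) := by
    rw [cos_add_cos, ← cos_neg (((Real.pi : ℂ) * s - Real.pi * (2 * z - s)) / 2)]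
    congr 3 <;> ring
  refine ⟨Real.Gamma (2 * s) / Real.sin (Real.pi * s) / (2 * Real.pi),
    div_pos (Gamma_div_sin_pos hs0 hs1) (by positivity), ?_⟩
  rw [e1, cosRatio, e2, e3, ofReal_div _ (2 * Real.pi)]
  generalize ((Real.Gamma (2 * s) / Real.sin (Real.pi * s) : ℝ) : ℂ) = K
  generalize Gamma (z + 1 / 2 - s) = A at *
  generalize Gamma (s + 1 / 2 + z) = B at *
  push_cast
  field_simp

/-- Both needed inequalities, cos(πx) < sin(πs) and Γ(2s)Γ(1) ≤ Γ(s+1/2-x)Γ(s+1/2+x), follow from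
|s-1/2| < x. The bound is sharp: F = 1 at x = |s-1/2|. -/
theorem cosRatio_ofReal_lt_one {s : ℝ} (hs0 : 0 < s) (hs1 : s < 1) {x : ℝ}
    (h0 : |s - 1 / 2| < x) (hxa : x ≤ s + 1 / 2) (hx1 : x ≤ 1) :
    (cosRatio s x).re < 1 := by
  rw [cosRatio_ofReal, Complex.ofReal_re]
  have hS := sin_pi_mul_pos hs0 hs1
  have hK := Gamma_div_sin_pos hs0 hs1
  have hx0 : 0 < x := (abs_nonneg _).trans_lt h0
  rcases eq_or_lt_of_le hxa with rfl | hxa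
  -- Here F = 0: the conventions Γ(0) = 0 and 0⁻¹ = 0 agree with the entire function 1/Γ.
  · simp [Real.Gamma_zero]
  have hp : 0 < Real.Gamma (s + 1 / 2 + x) := Real.Gamma_pos_of_pos (by linarith)
  have hm : 0 < Real.Gamma (s + 1 / 2 - x) := Real.Gamma_pos_of_pos (by linarith)
  obtain ⟨ha, hb⟩ := abs_lt.1 h0
  have hG : Real.Gamma (2 * s) ≤ Real.Gamma (s + 1 / 2 - x) * Real.Gamma (s + 1 / 2 + x) := by
    have := Real.Gamma_mul_Gamma_le_of_spread (p := s + 1 / 2 - x) (q := s + 1 / 2 + x)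
      (u := 2 * s) (v := 1) (by linarith) (by linarith) (by linarith) (by ring)
    rwa [Real.Gamma_one, mul_one] at this
  have hc : Real.cos (Real.pi * x) < Real.sin (Real.pi * s) := by
    rw [← Real.cos_pi_div_two_sub, ← Real.cos_abs (_ - _)]
    refine Real.cos_lt_cos_of_nonneg_of_le_pi (abs_nonneg _) (by nlinarith [Real.pi_pos]) ?_
    rw [abs_lt]
    constructor <;> nlinarith [Real.pi_pos]
  have hG2 := Real.Gamma_pos_of_pos (show 0 < 2 * s by linarith)
  have e : Real.cos (Real.pi * x) * ((Real.Gamma (s + 1 / 2 + x))⁻¹ *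
      (Real.Gamma (s + 1 / 2 - x))⁻¹) * (Real.Gamma (2 * s) / Real.sin (Real.pi * s)) =
      Real.cos (Real.pi * x) * Real.Gamma (2 * s) /
        (Real.sin (Real.pi * s) * (Real.Gamma (s + 1 / 2 - x) * Real.Gamma (s + 1 / 2 + x))) := by
    field_simp
  rw [e, div_lt_one (by positivity)]
  nlinarith [mul_lt_mul_of_pos_right hc hG2, mul_le_mul_of_nonneg_left hG hS.le]

theorem sinh_pi_mul_pos {y : ℝ} (hy : 0 < y) : 0 < Real.sinh (Real.pi * y) :=
  Real.sinh_pos_iff.2 (by positivity)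

-- The bound Re z ≤ 1 serves twice: it gives c = 2 Re z ≤ 2, so Im Q > 0, and sin(π Re z) ≥ 0, so Im
-- cos(πz) ≤ 0.
open Complex ComplexConjugate in
theorem cosRatio_ne_one_of_im_pos {s : ℝ} (hs0 : 0 < s) (hs1 : s < 1) {z : ℂ}
    (hx0 : 0 < z.re) (hxa : z.re < s + 1 / 2) (hx1 : z.re ≤ 1) (hy : 0 < z.im) :
    cosRatio s z ≠ 1 := by
  intro h
  obtain ⟨k, hk, hkz⟩ := cosRatio_mul_Gamma_quotient hs0 hs1 hx0 hxa
  have hR := Gamma_quotient_im_pos (c := 2 * z.re) (w := s + 1 / 2 - conj z) (by linarith)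
    (by linarith) (by simp; linarith) (by simpa using hy)
  rw [h, one_mul] at hkz
  rw [hkz, im_ofReal_mul, cos_pi_mul_im] at hR
  have h1 : 0 ≤ Real.sin (Real.pi * z.re) :=
    Real.sin_nonneg_of_nonneg_of_le_pi (by positivity) (by nlinarith [Real.pi_pos])
  have := mul_nonneg hk.le (mul_nonneg h1 (sinh_pi_mul_pos hy).le)
  linarith

open Complex ComplexConjugate in
theorem cosRatio_im_pos_of_re_eq_one {s : ℝ} (hs1 : s < 1) (hs : 1 / 2 < s) {z : ℂ}
    (hx : z.re = 1) (hy : 0 < z.im) : 0 < (cosRatio s z).im := by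
  obtain ⟨k, hk, hkz⟩ := cosRatio_mul_Gamma_quotient (s := s) (z := z) (by linarith) hs1
    (by linarith) (by linarith)
  have hR := Gamma_quotient_im_pos (c := 2 * z.re) (w := s + 1 / 2 - conj z) (by linarith)
    (by linarith) (by simp; linarith) (by simpa using hy)
  set R := Gamma (((s : ℂ) + 1 / 2 - conj z) + (2 * z.re : ℝ)) / Gamma (s + 1 / 2 - conj z)
  have hR0 : R ≠ 0 := fun h => by simp [h] at hR
  rw [eq_div_of_mul_eq hR0 hkz, div_im, im_ofReal_mul, re_ofReal_mul, cos_pi_mul_im,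
    cos_pi_mul_re, hx]
  have hN := normSq_pos.2 hR0
  have := Real.cosh_pos (Real.pi * z.im)
  simp only [mul_one, Real.cos_pi, Real.sin_pi]
  have : 0 < k * Real.cosh (Real.pi * z.im) * R.im / normSq R := by positivity
  calc 0 < _ := this
    _ = _ := by ring

theorem reflected_numerator_re (s : ℝ) (z : ℂ) :
    (Complex.cos (Real.pi * s) + Complex.cos (Real.pi * (2 * z - s))).re =
      Real.cos (Real.pi * s) +
        Real.cos (Real.pi * (2 * z.re - s)) * Real.cosh (Real.pi * (2 * z.im)) := by
  rw [Complex.add_re, cos_pi_mul_re, cos_pi_mul_re]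
  simp

theorem reflected_numerator_im (s : ℝ) (z : ℂ) :
    (Complex.cos (Real.pi * s) + Complex.cos (Real.pi * (2 * z - s))).im =
      -(Real.sin (Real.pi * (2 * z.re - s)) * Real.sinh (Real.pi * (2 * z.im))) := by
  rw [Complex.add_im, cos_pi_mul_im, cos_pi_mul_im]
  simp

-- The numerator has real part cos(πs)(1 - cosh) ≤ 0 and imaginary part sin(πs) sinh > 0, while s ≤
-- 1/2 makes c = 2s ≤ 1 and so puts Q in the open first quadrant.
open Complex in
theorem cosRatio_im_pos_of_re_eq_add_half {s : ℝ} (hs0 : 0 < s) (hs : s ≤ 1 / 2) {z : ℂ}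
    (hx : z.re = s + 1 / 2) (hy : 0 < z.im) : 0 < (cosRatio s z).im := by
  obtain ⟨k, hk, hkz⟩ := cosRatio_mul_Gamma_quotient_reflected (s := s) (z := z) hs0
    (by linarith) (by linarith)
  have hwx : 0 < (z + 1 / 2 - (s : ℂ)).re := by simp; linarith
  have hwy : 0 < (z + 1 / 2 - (s : ℂ)).im := by simpa using hy
  have hI := Gamma_quotient_im_pos (c := 2 * s) (by linarith) (by linarith) hwx hwy
  have hR := Gamma_quotient_re_pos (c := 2 * s) (by linarith) (by linarith) hwx hwy
  set R := Gamma ((z + 1 / 2 - (s : ℂ)) + (2 * s : ℝ)) / Gamma (z + 1 / 2 - s)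
  have hR0 : R ≠ 0 := fun h => by simp [h] at hR
  have hN := normSq_pos.2 hR0
  rw [eq_div_of_mul_eq hR0 hkz, div_im, im_ofReal_mul, re_ofReal_mul, reflected_numerator_im,
    reflected_numerator_re, hx,
    show Real.pi * (2 * (s + 1 / 2) - s) = Real.pi * s + Real.pi by ring, Real.cos_add_pi,
    Real.sin_add_pi, ← sub_div]
  refine div_pos ?_ hN
  have h1 := sin_pi_mul_pos hs0 (by linarith)
  have h2 : 0 ≤ Real.cos (Real.pi * s) :=
    Real.cos_nonneg_of_neg_pi_div_two_le_of_le (by nlinarith [Real.pi_pos])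
      (by nlinarith [Real.pi_pos])
  have h3 := sinh_pi_mul_pos (show 0 < 2 * z.im by linarith)
  have h4 := Real.one_le_cosh (Real.pi * (2 * z.im))
  have p1 : 0 < k * Real.sin (Real.pi * s) * Real.sinh (Real.pi * (2 * z.im)) * R.re := by
    positivity
  have p2 := mul_nonneg (mul_nonneg (mul_nonneg hk.le h2) (sub_nonneg.2 h4)) hI.le
  nlinarith

-- The abscissa is chosen so that Re(2z-s) = 2: the numerator is then real and positive, and F is a
-- positive multiple of 1/Q.
open Complex in
theorem cosRatio_im_neg {s : ℝ} (hs0 : 0 < s) (hs1 : s < 1) {z : ℂ}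
    (hx : z.re = 1 + s / 2) (hy : 0 < z.im) : (cosRatio s z).im < 0 := by
  obtain ⟨k, hk, hkz⟩ := cosRatio_mul_Gamma_quotient_reflected (s := s) (z := z) hs0 hs1
    (by linarith)
  have hwx : 0 < (z + 1 / 2 - (s : ℂ)).re := by simp; linarith
  have hwy : 0 < (z + 1 / 2 - (s : ℂ)).im := by simpa using hy
  have hI := Gamma_quotient_im_pos (c := 2 * s) (by linarith) (by linarith) hwx hwy
  set R := Gamma ((z + 1 / 2 - (s : ℂ)) + (2 * s : ℝ)) / Gamma (z + 1 / 2 - s)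
  have hR0 : R ≠ 0 := fun h => by simp [h] at hI
  have hN := normSq_pos.2 hR0
  rw [eq_div_of_mul_eq hR0 hkz, div_im, im_ofReal_mul, re_ofReal_mul, reflected_numerator_im,
    reflected_numerator_re, hx,
    show Real.pi * (2 * (1 + s / 2) - s) = 2 * Real.pi by ring, Real.cos_two_pi,
    Real.sin_two_pi, ← sub_div]
  refine div_neg_of_neg_of_pos ?_ hN
  have h4 := Real.one_lt_cosh.2 (show Real.pi * (2 * z.im) ≠ 0 by positivity)
  have h5 := Real.neg_one_le_cos (Real.pi * s)
  have := mul_pos (mul_pos hk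
    (show 0 < Real.cos (Real.pi * s) + 1 * Real.cosh (Real.pi * (2 * z.im)) by linarith)) hI
  linarith

open Complex in
theorem cosRatio_re_nonneg_of_im_eq_zero {s : ℝ} (hs0 : 0 < s) (hs1 : s < 1) {z : ℂ}
    (hx0 : (s + 1) / 2 ≤ z.re) (hx1 : z.re ≤ 1 + s / 2) (hy : 0 < z.im)
    (him : (cosRatio s z).im = 0) : 0 ≤ (cosRatio s z).re := by
  obtain ⟨k, hk, hkz⟩ := cosRatio_mul_Gamma_quotient_reflected (s := s) (z := z) hs0 hs1
    (by linarith)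
  have hwx : 0 < (z + 1 / 2 - (s : ℂ)).re := by simp; linarith
  have hwy : 0 < (z + 1 / 2 - (s : ℂ)).im := by simpa using hy
  have hI := Gamma_quotient_im_pos (c := 2 * s) (by linarith) (by linarith) hwx hwy
  have h := congrArg im hkz
  rw [mul_im, him, zero_mul, add_zero, im_ofReal_mul, reflected_numerator_im] at h
  have h1 : Real.sin (Real.pi * (2 * z.re - s)) ≤ 0 := by
    rw [← Real.sin_sub_two_pi]
    exact Real.sin_nonpos_of_nonpos_of_neg_pi_le (by nlinarith [Real.pi_pos])
      (by nlinarith [Real.pi_pos])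
  have h3 := sinh_pi_mul_pos (show 0 < 2 * z.im by linarith)
  refine nonneg_of_mul_nonneg_left (h.symm ▸ ?_) hI
  exact mul_nonneg hk.le (by nlinarith)

open Complex in
/-- `cosRatio s` grows at least linearly along vertical lines, uniformly for `0 ≤ Re z ≤ 2`. -/
theorem exists_mul_abs_im_le_norm_cosRatio {s : ℝ} (hs0 : 0 < s) (hs1 : s < 1) :
    ∃ c : ℝ, 0 < c ∧ ∀ z : ℂ, 0 ≤ z.re → z.re ≤ 2 → 1 ≤ |z.im| →
      c * |z.im| ≤ ‖cosRatio s z‖ := by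
  have hcont : ContinuousOn Real.Gamma (Set.Icc (1 / 2) 4) := fun x hx =>
    (Real.differentiableAt_Gamma fun m => by
      have := hx.1
      have : (0 : ℝ) ≤ m := m.cast_nonneg
      linarith).continuousAt.continuousWithinAt
  obtain ⟨M, hM⟩ := isCompact_Icc.bddAbove_image hcont
  have hM' : ∀ x : ℝ, 1 / 2 ≤ x → x ≤ 4 → Real.Gamma x ≤ M := fun x h1 h2 =>
    hM ⟨x, ⟨h1, h2⟩, rfl⟩
  have hM0 : 0 < M := (Real.Gamma_pos_of_pos one_pos).trans_le (hM' 1 (by norm_num) (by norm_num))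
  have hK := Gamma_div_sin_pos hs0 hs1
  refine ⟨(M⁻¹ * M⁻¹) * (Real.Gamma (2 * s) / Real.sin (Real.pi * s)), by positivity,
    fun z h0 h2 hy => ?_⟩
  have hp : ‖Gamma (s + 1 / 2 + z)‖ ≤ M :=
    (norm_Gamma_le_Gamma_re (by simp; linarith)).trans
      (hM' _ (by simp; linarith) (by simp; linarith))
  have hp0 : Gamma (s + 1 / 2 + z) ≠ 0 := Gamma_ne_zero_of_re_pos (by simp; linarith)
  set u : ℂ := s + 1 / 2 - z with hu
  have hui : |u.im| = |z.im| := by simp [hu]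
  have hu1 : 1 ≤ ‖u‖ := hy.trans (hui ▸ abs_im_le_norm u)
  have hu2 : 1 ≤ ‖u + 1‖ := by
    have := abs_im_le_norm (u + 1)
    rw [add_im, one_im, add_zero, hui] at this
    exact hy.trans this
  -- Re u may be negative; two shifts bring it into the range of `hM'`, and |Im u| ≥ 1 makes both
  -- factors at least 1 in modulus.
  have hrec : Gamma (u + 2) = (u + 1) * (u * Gamma u) := by
    rw [show u + 2 = u + 1 + 1 by ring, Gamma_add_one (u + 1) (norm_pos_iff.1 (by linarith)),
      Gamma_add_one u (norm_pos_iff.1 (by linarith))]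
  have hu2re : (u + 2).re = s + 1 / 2 - z.re + 2 := by simp [hu]
  have hm0 : Gamma u ≠ 0 := by
    have : Gamma (u + 2) ≠ 0 := Gamma_ne_zero_of_re_pos (by linarith)
    rw [hrec] at this
    exact right_ne_zero_of_mul (right_ne_zero_of_mul this)
  have hm : ‖Gamma u‖ ≤ M := by
    have h3 : ‖Gamma (u + 2)‖ ≤ M := (norm_Gamma_le_Gamma_re (by linarith)).trans
      (hM' _ (by linarith) (by linarith))
    rw [hrec, norm_mul, norm_mul] at h3
    have h4 := le_mul_of_one_le_left (norm_nonneg (Gamma u)) hu1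
    have h5 := le_mul_of_one_le_left (mul_nonneg (norm_nonneg u) (norm_nonneg (Gamma u))) hu2
    linarith
  have hcos : |z.im| ≤ ‖cos (Real.pi * z)‖ := by
    refine le_trans ?_ (abs_sinh_le_norm_cos_pi_mul z)
    rw [Real.abs_sinh, abs_mul, abs_of_pos Real.pi_pos]
    refine le_trans ?_ (Real.self_le_sinh_iff.2 (by positivity))
    nlinarith [Real.pi_gt_three, abs_nonneg z.im]
  rw [cosRatio, norm_mul, norm_mul, norm_mul, norm_inv, norm_inv, norm_real, Real.norm_eq_abs,
    abs_of_pos hK]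
  have i1 : M⁻¹ ≤ ‖Gamma (s + 1 / 2 + z)‖⁻¹ := inv_anti₀ (norm_pos_iff.2 hp0) hp
  have i2 : M⁻¹ ≤ ‖Gamma u‖⁻¹ := inv_anti₀ (norm_pos_iff.2 hm0) hm
  have i3 : |z.im| * (M⁻¹ * M⁻¹) ≤
      ‖cos (Real.pi * z)‖ * (‖Gamma (s + 1 / 2 + z)‖⁻¹ * ‖Gamma u‖⁻¹) := by gcongr
  calc _ = |z.im| * (M⁻¹ * M⁻¹) * (Real.Gamma (2 * s) / Real.sin (Real.pi * s)) := by ring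
    _ ≤ _ := mul_le_mul_of_nonneg_right i3 hK.le

/-! ### Solutions of F = 1: the gap and the existence -/

theorem cosRatio_im_pos_of_re_eq_min {s : ℝ} (hs0 : 0 < s) (hs1 : s < 1) {z : ℂ}
    (hx : z.re = min (s + 1 / 2) 1) (hy : 0 < z.im) : 0 < (cosRatio s z).im := by
  rcases le_or_gt s (1 / 2) with hs | hs
  · exact cosRatio_im_pos_of_re_eq_add_half hs0 hs (by rw [hx, min_eq_left (by linarith)]) hy
  · exact cosRatio_im_pos_of_re_eq_one hs1 hs (by rw [hx, min_eq_right (by linarith)]) hy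

open Complex ComplexConjugate in
theorem cosRatio_ne_one {s : ℝ} (hs0 : 0 < s) (hs1 : s < 1) {z : ℂ}
    (h0 : |s - 1 / 2| < z.re) (h1 : z.re ≤ min (s + 1 / 2) 1) : cosRatio s z ≠ 1 := by
  have hx0 : 0 < z.re := (abs_nonneg _).trans_lt h0
  have upper : ∀ u : ℂ, u.re = z.re → 0 < u.im → cosRatio s u ≠ 1 := by
    intro u hu hy
    rcases eq_or_lt_of_le h1 with h | h
    · intro he
      have := cosRatio_im_pos_of_re_eq_min hs0 hs1 (hu.trans h) hy
      simp [he] at this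
    · obtain ⟨h2, h3⟩ := lt_min_iff.1 h
      exact cosRatio_ne_one_of_im_pos hs0 hs1 (by rwa [hu]) (by rwa [hu]) (by rw [hu]; exact h3.le)
        hy
  rcases lt_trichotomy z.im 0 with hy | hy | hy
  · intro he
    refine upper (conj z) (by simp) (by simpa using hy) ?_
    rw [cosRatio_conj, he, map_one]
  · intro he
    obtain ⟨h2, h3⟩ := le_min_iff.1 h1
    have := cosRatio_ofReal_lt_one hs0 hs1 h0 h2 h3
    rw [show (z.re : ℂ) = z from Complex.ext (by simp) (by simp [hy]), he] at this
    simp at this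
  · exact upper z rfl hy

theorem exists_forall_cosRatio_ne_one {s : ℝ} (hs0 : 0 < s) (hs1 : s < 1) :
    ∃ α : ℝ, 0 < α ∧ ∀ z : ℂ, |s - 1 / 2| < z.re → z.re < min (s + 1 / 2) 1 + α →
      cosRatio s z ≠ 1 := by
  obtain ⟨c, hc, hgrow⟩ := exists_mul_abs_im_le_norm_cosRatio hs0 hs1
  set m := min (s + 1 / 2) 1 with hm
  have hm0 : |s - 1 / 2| < m := by
    rw [abs_lt, hm, lt_min_iff, neg_lt, lt_min_iff]
    refine ⟨⟨?_, ?_⟩, ?_, ?_⟩ <;> linarith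
  have hm1 : m ≤ 1 := min_le_right _ _
  have hm2 : 0 ≤ m := (abs_nonneg _).trans hm0.le
  -- Beyond this height the growth bound gives |F| > 1.
  set Y := 1 + 1 / c with hY
  let S : Set ℂ := (Set.Icc m (m + 1) ×ℂ Set.Icc (-Y) Y) ∩ {z | cosRatio s z = 1}
  have hS : IsCompact S := (isCompact_Icc.reProdIm isCompact_Icc).inter_right
    (isClosed_eq (differentiable_cosRatio s).continuous continuous_const)
  have hmem : ∀ z : ℂ, m ≤ z.re → z.re ≤ m + 1 → cosRatio s z = 1 → z ∈ S := by
    intro z h1 h2 h3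
    refine ⟨⟨⟨h1, h2⟩, abs_le.1 ?_⟩, h3⟩
    by_contra! h
    have hc' : 0 < 1 / c := by positivity
    have h4 := hgrow z (by linarith) (by linarith) (by linarith)
    rw [h3, norm_one] at h4
    have h5 : c * (1 + 1 / c) < c * |z.im| := mul_lt_mul_of_pos_left h hc
    have h6 : c * (1 + 1 / c) = c + 1 := by field_simp
    linarith
  rcases S.eq_empty_or_nonempty with hE | hne
  · refine ⟨1, one_pos, fun z h0 h1 h => ?_⟩
    rcases le_or_gt z.re m with h2 | h2
    · exact cosRatio_ne_one hs0 hs1 h0 h2 h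
    · have := hmem z h2.le h1.le h
      simp [hE] at this
  · obtain ⟨z₀, hz₀, hmin⟩ := hS.exists_isMinOn hne Complex.continuous_re.continuousOn
    have hlt : m < z₀.re := by
      refine lt_of_le_of_ne hz₀.1.1.1 fun h => ?_
      exact cosRatio_ne_one hs0 hs1 (h ▸ hm0) h.symm.le hz₀.2
    refine ⟨z₀.re - m, by linarith, fun z h0 h1 h => ?_⟩
    rcases le_or_gt z.re m with h2 | h2
    · exact cosRatio_ne_one hs0 hs1 h0 h2 h
    · have h3 : z₀.re ≤ m + 1 := hz₀.1.1.2
      have h4 : z₀.re ≤ z.re := hmin (hmem z h2.le (by linarith) h)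
      linarith

open Complex Filter Topology in
theorem exists_cosRatio_eq_one {s : ℝ} (hs0 : 0 < s) (hs1 : s < 1) :
    ∃ z : ℂ, min (s + 1 / 2) 1 < z.re ∧ z.re ≤ 1 + s / 2 ∧ cosRatio s z = 1 := by
  obtain ⟨c, hc, hgrow⟩ := exists_mul_abs_im_le_norm_cosRatio hs0 hs1
  set m := min (s + 1 / 2) 1 with hm
  have hm0 : |s - 1 / 2| < m := by
    rw [abs_lt, hm, lt_min_iff, neg_lt, lt_min_iff]
    refine ⟨⟨?_, ?_⟩, ?_, ?_⟩ <;> linarith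
  have hm1 : m ≤ 1 := min_le_right _ _
  have hm2 : 0 ≤ m := (abs_nonneg _).trans hm0.le
  have hm3 : (s + 1) / 2 ≤ m := le_min (by linarith) (by linarith)
  have hmx : m ≤ 1 + s / 2 := by linarith
  have hF : Continuous (cosRatio s) := (differentiable_cosRatio s).continuous
  have hFm : (cosRatio s m).re < 1 :=
    cosRatio_ofReal_lt_one hs0 hs1 hm0 (min_le_left _ _) hm1
  -- If F reaches 1 on the real segment, the intermediate value theorem finishes; otherwise F < 1 on
  -- the bottom edge.
  by_cases hreal : ∃ x : ℝ, m ≤ x ∧ x ≤ 1 + s / 2 ∧ 1 ≤ (cosRatio s x).re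
  · obtain ⟨x, hx0, hx1, hx⟩ := hreal
    obtain ⟨t, ⟨ht0, ht1⟩, ht⟩ := intermediate_value_Icc hx0
      (f := fun t : ℝ => (cosRatio s t).re)
      (continuous_re.comp (hF.comp continuous_ofReal)).continuousOn ⟨hFm.le, hx⟩
    simp only at ht
    refine ⟨t, ?_, by simpa using ht1.trans hx1, ?_⟩
    · rw [ofReal_re]
      refine lt_of_le_of_ne ht0 fun h => ?_
      rw [← h] at ht
      exact hFm.ne ht
    · apply Complex.ext
      · simpa using ht
      · rw [cosRatio_ofReal, ofReal_im, one_im]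
  push Not at hreal
  have hbot : ∀ z : ℂ, m ≤ z.re → z.re ≤ 1 + s / 2 → z.im = 0 → (cosRatio s z).re < 1 := by
    intro z h0 h1 h2
    have := hreal z.re h0 h1
    rwa [show (z.re : ℂ) = z from Complex.ext (by simp) (by simp [h2])] at this
  have hnorm : ∀ {z : ℂ}, (cosRatio s z).im = 0 → ‖cosRatio s z‖ = |(cosRatio s z).re| := by
    intro z h
    exact (abs_re_eq_norm.2 h).symm
  obtain ⟨z₁, hz₁0, hz₁1, hz₁y, hz₁im, hz₁re⟩ : ∃ z₁ : ℂ, m ≤ z₁.re ∧ z₁.re ≤ 1 + s / 2 ∧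
      1 ≤ z₁.im ∧ (cosRatio s z₁).im = 0 ∧ 2 ≤ (cosRatio s z₁).re := by
    have hc' : 0 < 2 / c := by positivity
    obtain ⟨x, ⟨hx0, hx1⟩, hx⟩ := intermediate_value_Icc' hmx
      (f := fun t : ℝ => (cosRatio s (⟨t, 1 + 2 / c⟩ : ℂ)).im)
      (by
        have : Continuous fun t : ℝ => (⟨t, 1 + 2 / c⟩ : ℂ) := by
          have e : (fun t : ℝ => (⟨t, 1 + 2 / c⟩ : ℂ)) =
              fun t : ℝ => (t : ℂ) + ((1 + 2 / c : ℝ) : ℂ) * I := by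
            funext t; apply Complex.ext <;> simp
          rw [e]; fun_prop
        exact (continuous_im.comp (hF.comp this)).continuousOn)
      (show (0 : ℝ) ∈ Set.Icc _ _ from
        ⟨(cosRatio_im_neg hs0 hs1 rfl (by simp only; linarith)).le,
          (cosRatio_im_pos_of_re_eq_min hs0 hs1 rfl (by simp only; linarith)).le⟩)
    simp only at hx
    have h0 := cosRatio_re_nonneg_of_im_eq_zero (z := ⟨x, 1 + 2 / c⟩) hs0 hs1 (hm3.trans hx0) hx1
      (by simp only; linarith) hx
    have h1 := hgrow ⟨x, 1 + 2 / c⟩ (by simp only; linarith) (by simp only; linarith)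
      (by simp only; rw [abs_of_pos] <;> linarith)
    rw [hnorm hx, abs_of_nonneg h0] at h1
    simp only at h1
    rw [abs_of_pos (by linarith), mul_add, mul_div_cancel₀ _ hc.ne'] at h1
    exact ⟨⟨x, 1 + 2 / c⟩, hx0, hx1, by simp only; linarith, hx, by linarith⟩
  set L := (cosRatio s z₁).re with hL
  -- The box contains z₁, and |F| > L on its top edge, so no competitor with 1 ≤ F ≤ L lies there.
  set Y := z₁.im + L / c + 1 with hY
  have hLc : 0 < L / c := by positivity
  have htop : ∀ z : ℂ, m ≤ z.re → z.re ≤ 1 + s / 2 → z.im = Y → L < ‖cosRatio s z‖ := by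
    intro z h0 h1 h2
    have h3 := hgrow z (by linarith) (by linarith) (by rw [h2, abs_of_pos] <;> linarith)
    rw [h2, abs_of_pos (by linarith)] at h3
    have h4 : c * (L / c) < c * Y := mul_lt_mul_of_pos_left (by linarith) hc
    rw [mul_div_cancel₀ _ hc.ne'] at h4
    linarith
  let S : Set ℂ := (Set.Icc m (1 + s / 2) ×ℂ Set.Icc 0 Y) ∩
    {z | (cosRatio s z).im = 0 ∧ 1 ≤ (cosRatio s z).re ∧ (cosRatio s z).re ≤ L}
  have hFre : Continuous fun z => (cosRatio s z).re := continuous_re.comp hF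
  have hFim : Continuous fun z => (cosRatio s z).im := continuous_im.comp hF
  have hS : IsCompact S := (isCompact_Icc.reProdIm isCompact_Icc).inter_right
    ((isClosed_eq hFim continuous_const).inter
      ((isClosed_le continuous_const hFre).inter (isClosed_le hFre continuous_const)))
  obtain ⟨z₀, hz₀, hmin⟩ := hS.exists_isMinOn
    ⟨z₁, ⟨⟨hz₁0, hz₁1⟩, by linarith, by linarith⟩, hz₁im, by linarith, le_rfl⟩ hFre.continuousOn
  obtain ⟨⟨⟨hx0, hx1⟩, hy0, hy1⟩, him, hre1, hreL⟩ := hz₀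
  have hy0' : 0 < z₀.im := by
    refine lt_of_le_of_ne hy0 fun h => ?_
    have := hbot z₀ hx0 hx1 h.symm
    linarith
  have hx0' : m < z₀.re := by
    refine lt_of_le_of_ne hx0 fun h => ?_
    have := cosRatio_im_pos_of_re_eq_min hs0 hs1 h.symm hy0'
    linarith
  have hx1' : z₀.re < 1 + s / 2 := by
    refine lt_of_le_of_ne hx1 fun h => ?_
    have := cosRatio_im_neg hs0 hs1 h hy0'
    linarith
  have hy1' : z₀.im < Y := by
    refine lt_of_le_of_ne hy1 fun h => ?_
    have := htop z₀ hx0 hx1 h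
    rw [hnorm him, abs_of_nonneg (by linarith)] at this
    linarith
  refine ⟨z₀, hx0', hx1, ?_⟩
  rcases eq_or_lt_of_le hre1 with h | h
  · exact Complex.ext (by simpa using h.symm) (by simpa using him)
  exfalso
  have hopen : IsOpenMap (cosRatio s) := by
    rcases (Complex.analyticOnNhd_univ_iff_differentiable.2
      (differentiable_cosRatio s)).is_constant_or_isOpenMap with ⟨w, hw⟩ | ho
    · rw [hw] at hFm
      rw [hw] at hL
      linarith
    · exact ho
  have hU : Set.Ioo m (1 + s / 2) ×ℂ Set.Ioo 0 Y ∈ 𝓝 z₀ :=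
    (isOpen_Ioo.reProdIm isOpen_Ioo).mem_nhds ⟨⟨hx0', hx1'⟩, hy0', hy1'⟩
  have himg := hopen.image_mem_nhds hU
  have hval : cosRatio s z₀ = ((cosRatio s z₀).re : ℂ) :=
    Complex.ext (by simp) (by simpa using him)
  rw [hval] at himg
  have hev := (continuous_ofReal.tendsto (cosRatio s z₀).re).eventually himg
  -- Openness yields a real value t of F in the box with 1 < t < F(z₀), against minimality.
  obtain ⟨t, ⟨⟨z, ⟨⟨ha, hb⟩, hc, hd⟩, hz⟩, ht1⟩, ht⟩ := (((hev.and (lt_mem_nhds h)).filter_mono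
    nhdsWithin_le_nhds).and (self_mem_nhdsWithin (s := Set.Iio (cosRatio s z₀).re))).exists
  have ht' : t < (cosRatio s z₀).re := ht
  have hzS : z ∈ S := by
    refine ⟨⟨⟨ha.le, hb.le⟩, hc.le, hd.le⟩, ?_, ?_, ?_⟩
    · rw [hz, ofReal_im]
    · rw [hz, ofReal_re]; exact ht1.le
    · rw [hz, ofReal_re]; linarith
  have h5 : (cosRatio s z₀).re ≤ (cosRatio s z).re := hmin hzS
  rw [hz, ofReal_re] at h5
  linarith

/-! ### From zeros of the symbol to solutions of F = 1 -/

open Complex Filter Topology in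
theorem eventually_sin_pi_mul_sub_ne_zero (c β : ℂ) :
    ∀ᶠ z in 𝓝[≠] β, sin (Real.pi * (z - c)) ≠ 0 := by
  have hd : Differentiable ℂ fun z : ℂ => sin (Real.pi * (z - c)) := by fun_prop
  have ha := Complex.analyticOnNhd_univ_iff_differentiable.2 hd
  rcases (ha β trivial).eventually_eq_zero_or_eventually_ne_zero with h | h
  · have h0 := ha.eqOn_zero_of_preconnected_of_eventuallyEq_zero isPreconnected_univ trivial h
      (Set.mem_univ (c + 1 / 2))
    simp only [add_sub_cancel_left, mul_one_div, sin_pi_div_two, Pi.zero_apply] at h0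
    exact absurd h0 one_ne_zero
  · exact h

open Complex in
theorem neumannSymbol_eq_of_sin_ne_zero {s : ℝ} (hs0 : 0 < s) (hs1 : s < 1) {β : ℂ}
    (h : sin (Real.pi * (β - 2 * s)) ≠ 0) :
    neumannSymbol s β = -(Real.sin (Real.pi * s) / (Real.pi * Real.Gamma (2 * s)) : ℝ) *
      (Gamma (β + 1) * Gamma (2 * s - β)) ^ 2 * (1 - cosRatio s (β - s + 1 / 2)) := by
  have hS : (Real.sin (Real.pi * s) : ℂ) ≠ 0 := ofReal_ne_zero.2 (sin_pi_mul_pos hs0 hs1).ne'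
  have hG : (Real.Gamma (2 * s) : ℂ) ≠ 0 :=
    ofReal_ne_zero.2 (Real.Gamma_pos_of_pos (by linarith)).ne'
  have hpi : (Real.pi : ℂ) ≠ 0 := ofReal_ne_zero.2 Real.pi_ne_zero
  have hr := Gamma_mul_Gamma_one_sub (2 * s - β)
  rw [show (1 : ℂ) - (2 * s - β) = β - 2 * s + 1 by ring,
    show (Real.pi : ℂ) * (2 * s - β) = -(Real.pi * (β - 2 * s)) by ring, sin_neg] at hr
  have hne : Gamma (2 * s - β) * Gamma (β - 2 * s + 1) ≠ 0 := by
    rw [hr]; exact div_ne_zero hpi (neg_ne_zero.2 h)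
  have hA := left_ne_zero_of_mul hne
  have hB := right_ne_zero_of_mul hne
  have hD : Gamma (β - 2 * s + 1) * sin (Real.pi * (β - 2 * s)) =
      -Real.pi / Gamma (2 * s - β) := by
    rw [eq_div_iff hA, mul_right_comm, mul_comm (Gamma (β - 2 * s + 1)), hr]
    field_simp
  have e1 : (s : ℂ) + 1 / 2 + (β - s + 1 / 2) = β + 1 := by ring
  have e2 : (s : ℂ) + 1 / 2 - (β - s + 1 / 2) = 2 * s - β := by ring
  have e3 : cos (Real.pi * (β - s + 1 / 2)) = -sin (Real.pi * (β - s)) := by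
    rw [← cos_add_pi_div_two]; congr 1; ring
  have e4 : Gamma (2 * s) = (Real.Gamma (2 * s) : ℂ) := by
    rw [← Gamma_ofReal]; push_cast; rfl
  have e5 : sin (Real.pi * s) = (Real.sin (Real.pi * s) : ℂ) := by push_cast; rfl
  rw [neumannSymbol, hD, cosRatio, e1, e2, e3, e4, e5, ofReal_div, ofReal_div, ofReal_mul]
  generalize (Real.sin (Real.pi * s) : ℂ) = S at *
  generalize (Real.Gamma (2 * s) : ℂ) = G at *
  generalize Gamma (2 * s - β) = A at *
  generalize sin (Real.pi * (β - s)) = T at *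
  rcases eq_or_ne (Gamma (β + 1)) 0 with h0 | h0
  · simp [h0]
  generalize Gamma (β + 1) = C at *
  field_simp
  ring

open Complex Filter Topology in
theorem isZeroOf_neumannSymbol_iff {s : ℝ} (hs0 : 0 < s) (hs1 : s < 1) (β : ℂ) :
    IsZeroOf (neumannSymbol s) β ↔ cosRatio s (β - s + 1 / 2) = 1 := by
  rw [IsZeroOf, ← tendsto_zero_iff_meromorphicOrderAt_pos (neumannSymbol_meromorphicAt s β)]
  set r : ℂ → ℂ := fun z => (Gamma (z + 1))⁻¹ * (Gamma (2 * s - z))⁻¹ with hr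
  set κ : ℂ := -(Real.sin (Real.pi * s) / (Real.pi * Real.Gamma (2 * s)) : ℝ) with hκ
  have hκ0 : κ ≠ 0 := by
    refine neg_ne_zero.2 (ofReal_ne_zero.2 (div_ne_zero (sin_pi_mul_pos hs0 hs1).ne' ?_))
    exact mul_ne_zero Real.pi_ne_zero (Real.Gamma_pos_of_pos (by linarith)).ne'
  have hrc : Continuous r :=
    (differentiable_one_div_Gamma.continuous.comp (continuous_id.add continuous_const)).mul
      (differentiable_one_div_Gamma.continuous.comp (continuous_const.sub continuous_id))
  have hFc : Continuous fun z : ℂ => κ * (1 - cosRatio s (z - s + 1 / 2)) := by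
    have := (differentiable_cosRatio s).continuous
    fun_prop
  have heq : ∀ᶠ z in 𝓝[≠] β,
      neumannSymbol s z = κ * (1 - cosRatio s (z - s + 1 / 2)) / r z ^ 2 := by
    filter_upwards [eventually_sin_pi_mul_sub_ne_zero (2 * s) β] with z hz
    rw [neumannSymbol_eq_of_sin_ne_zero hs0 hs1 hz,
      show r z = (Gamma (z + 1))⁻¹ * (Gamma (2 * s - z))⁻¹ from rfl, ← mul_inv, inv_pow,
      div_inv_eq_mul]
    ring
  have hFlim := (hFc.tendsto β).mono_left (nhdsWithin_le_nhds (s := {β}ᶜ))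
  have hrlim := ((hrc.pow 2).tendsto β).mono_left (nhdsWithin_le_nhds (s := {β}ᶜ))
  -- r is a factor of F, so a solution of F = 1 is never cancelled by a pole of 1/r².
  have hF0 : cosRatio s (β - s + 1 / 2) = 1 → r β ≠ 0 := by
    intro h h0
    have e1 : (s : ℂ) + 1 / 2 + (β - s + 1 / 2) = β + 1 := by ring
    have e2 : (s : ℂ) + 1 / 2 - (β - s + 1 / 2) = 2 * s - β := by ring
    rw [cosRatio, e1, e2] at h
    simp only [hr] at h0
    rw [h0] at h
    simp at h
  constructor
  · intro h
    by_contra hne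
    have hrne : ∀ᶠ z in 𝓝[≠] β, r z ≠ 0 := by
      filter_upwards [eventually_sin_pi_mul_sub_ne_zero (2 * s) β,
        eventually_sin_pi_mul_sub_ne_zero 0 β] with z hz hz0
      have g1 := Gamma_mul_Gamma_one_sub (2 * s - z)
      have g2 := Gamma_mul_Gamma_one_sub (z + 1)
      have hpi : (Real.pi : ℂ) ≠ 0 := ofReal_ne_zero.2 Real.pi_ne_zero
      refine mul_ne_zero (inv_ne_zero (left_ne_zero_of_mul (g2 ▸ div_ne_zero hpi ?_)))
        (inv_ne_zero (left_ne_zero_of_mul (g1 ▸ div_ne_zero hpi ?_)))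
      · rw [mul_add, mul_one, sin_add_pi, neg_ne_zero]
        simpa using hz0
      · rw [show (Real.pi : ℂ) * (2 * s - z) = -(Real.pi * (z - 2 * s)) by ring, sin_neg,
          neg_ne_zero]
        exact hz
    -- Multiplying back by the continuous function r² turns the limit 0 of the symbol into κ(1 - F)
    -- = 0 at β.
    have h2 := (h.mul hrlim).congr' (f₂ := fun z => κ * (1 - cosRatio s (z - s + 1 / 2))) (by
      filter_upwards [heq, hrne] with z hz hz0
      rw [hz, Pi.pow_apply, div_mul_cancel₀ _ (pow_ne_zero 2 hz0)])
    have h3 := tendsto_nhds_unique h2 hFlim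
    rw [zero_mul] at h3
    exact mul_ne_zero hκ0 (sub_ne_zero.2 (Ne.symm hne)) h3.symm
  · intro h
    have h2 := hFlim.div hrlim (pow_ne_zero 2 (hF0 h))
    rw [h, sub_self, mul_zero, zero_div] at h2
    exact h2.congr' (heq.mono fun z hz => hz.symm)

theorem proposition1p3 (s : ℝ) (hs0 : 0 < s) (hs1 : s < 1) :
    (s ≤ 1 / 2 →
      (∃ α : ℝ, 0 < α ∧ ∀ β : ℂ, 0 < β.re → β.re < 2 * s + α →
        ¬ IsZeroOf (neumannSymbol s) β) ∧
      (∃ β : ℂ, 2 * s < β.re ∧ β.re < 2 * s + 1 / 2 ∧ IsZeroOf (neumannSymbol s) β)) ∧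
    (1 / 2 ≤ s →
      (∃ α : ℝ, 0 < α ∧ ∀ β : ℂ, 2 * s - 1 < β.re → β.re < s + 1 / 2 + α →
        ¬ IsZeroOf (neumannSymbol s) β) ∧
      (∃ β : ℂ, s + 1 / 2 < β.re ∧ β.re < s + 1 ∧ IsZeroOf (neumannSymbol s) β)) := by
  obtain ⟨α, hα, hgap⟩ := exists_forall_cosRatio_ne_one hs0 hs1
  obtain ⟨z, hz0, hz1, hz⟩ := exists_cosRatio_eq_one hs0 hs1
  have hre : ∀ β : ℂ, (β - s + 1 / 2).re = β.re - s + 1 / 2 := fun β => by simp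
  have hzero : IsZeroOf (neumannSymbol s) (z + s - 1 / 2) := by
    rw [isZeroOf_neumannSymbol_iff hs0 hs1, ← hz]
    congr 1
    ring
  have hzre : (z + s - 1 / 2).re = z.re + s - 1 / 2 := by simp
  refine ⟨fun hs => ?_, fun hs => ?_⟩
  · rw [min_eq_left (by linarith)] at hgap hz0
    -- Re z ≤ 1+s/2 gives Re β ≤ (3s+1)/2, which is below 2s+1/2 as s > 0 and, in the other case,
    -- below s+1 as s < 1.
    refine ⟨⟨α, hα, fun β h0 h1 h => ?_⟩, z + s - 1 / 2, by linarith, by linarith, hzero⟩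
    refine hgap _ ?_ ?_ ((isZeroOf_neumannSymbol_iff hs0 hs1 β).1 h)
    · rw [hre, abs_of_nonpos (by linarith)]; linarith
    · rw [hre]; linarith
  · rw [min_eq_right (by linarith)] at hgap hz0
    refine ⟨⟨α, hα, fun β h0 h1 h => ?_⟩, z + s - 1 / 2, by linarith, by linarith, hzero⟩
    refine hgap _ ?_ ?_ ((isZeroOf_neumannSymbol_iff hs0 hs1 β).1 h)
    · rw [hre, abs_of_nonneg (by linarith)]; linarith
    · rw [hre]; linarith
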